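/- A *left brace* is a set $A$ with two operations such that $(A,+)$ is an abelian group, $(A,\cdot)$ is a group, and $a(b+c)=ab+ac-a$ for all $a,b,c\in A$. Put $a\star b=ab-a-b$. A subbrace of $A$ is a subset that is a subgroup of both $(A,+)$ and $(A,\cdot)$; a subbrace $I$ of a left brace $B$ is an *ideal* of $B$ if $b\star z,\ z\star b\in I$ for all $b\in B$, $z\in I$. For subsets $K,L\subseteq A$, let $K\star L$ be the subgroup of $(A,+)$ generated by all $x\star y$ with $x\in K$, $y\in L$. A left brace $A$ is a *T-brace* if every ideal of an ideal of $A$ is an ideal of $A$. Let $A^{(1)}=A^{1}=A$, $A^{(n+1)}=A^{(n)}\star A$ and $A^{n+1}=A\star A^{n}$ for $n\ge 1$; $A$ is *Smoktunowicz-nilpotent* if $A^{(n)}=0=A^{m}$ for some positive integers $n,m$. The $\star$-center of a left brace $B$ is $\zeta(\star,B)=\{b\in B : b\star x=x\star b=0 \text{ for all } x\in B\}$. The upper $\star$-central series of $A$ is defined by $\zeta_0(\star,A)=0$, $\zeta_{\alpha+1}(\star,A)/\zeta_\alpha(\star,A)=\zeta(\star,A/\zeta_\alpha(\star,A))$ for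 every ordinal $\alpha$, and $\zeta_\lambda(\star,A)=\bigcup_{\mu<\lambda}\zeta_\mu(\star,A)$ for limit ordinals $\lambda$. Its length $\mathrm{zl}(A)$ is the least ordinal $\gamma$ with $\zeta_{\gamma+1}(\star,A)=\zeta_\gamma(\star,A)$. **Theorem.** Let $A$ be a T-brace. Suppose that $A$ is Smoktunowicz-nilpotent and that $\mathrm{zl}(A)=k$ for some positive integer $k$. If the additive group of $A$ is not periodic (that is, some element of $(A,+)$ has infinite order), then for every prime $p$ the Sylow $p$-subgroup of the additive group of $K=A\star A$ is finite of order at most $p^{k-1}$. -/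

import Mathlib

universe u

/-- A left brace (a skew left brace of abelian type): an abelian group `(A, +)` and a group
`(A, *)` on the same set, with `a * (b + c) = a * b + a * c - a`. -/
class LeftBrace (A : Type u) extends AddCommGroup A, Group A where
  mul_add_eq : ∀ a b c : A, a * (b + c) = a * b + a * c - a

/-- A subbrace of `A`: a subset which is a subgroup both of `(A, +)` and of `(A, *)`. -/
structure Subbrace (A : Type u) [LeftBrace A] extends AddSubgroup A, Subgroup A

namespace LeftBrace

/-- The operation `a ⋆ b = a * b - a - b`. -/
def starMul {A : Type u} [LeftBrace A] (a b : A) : A := a * b - a - b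

/-- `K ⋆ L`: the subgroup of `(A, +)` generated by all `x ⋆ y` with `x ∈ K`, `y ∈ L`. -/
def starProd {A : Type u} [LeftBrace A] (K L : Set A) : AddSubgroup A :=
  AddSubgroup.closure {z | ∃ x ∈ K, ∃ y ∈ L, z = starMul x y}

/-- `rightSeries A n` is `A^{(n+1)}`, where `A^{(1)} = A` and `A^{(n+1)} = A^{(n)} ⋆ A`. -/
def rightSeries (A : Type u) [LeftBrace A] : ℕ → AddSubgroup A
  | 0 => ⊤
  | n + 1 => starProd (rightSeries A n : Set A) Set.univ

/-- `leftSeries A n` is `A^{n+1}`, where `A^1 = A` and `A^{n+1} = A ⋆ A^n`. -/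
def leftSeries (A : Type u) [LeftBrace A] : ℕ → AddSubgroup A
  | 0 => ⊤
  | n + 1 => starProd Set.univ (leftSeries A n : Set A)

/-- `A` is Smoktunowicz-nilpotent: `A^{(n)} = 0` and `A^m = 0` for some positive integers
`n` and `m`. -/
def IsSmoktunowiczNilpotent (A : Type u) [LeftBrace A] : Prop :=
  ∃ n m : ℕ, rightSeries A n = ⊥ ∧ leftSeries A m = ⊥

/-- The subbrace `I` is an ideal of the brace `B`, where `B` is itself a subbrace of `A`:
`I ⊆ B`, and `b ⋆ z`, `z ⋆ b` belong to `I` for all `b ∈ B`, `z ∈ I`. -/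
def IsIdealOf {A : Type u} [LeftBrace A] (I B : Subbrace A) : Prop :=
  I.carrier ⊆ B.carrier ∧
    ∀ b ∈ B.carrier, ∀ z ∈ I.carrier, starMul b z ∈ I.carrier ∧ starMul z b ∈ I.carrier

/-- `A` as a subbrace of itself. -/
def topSubbrace (A : Type u) [LeftBrace A] : Subbrace A where
  carrier := Set.univ
  add_mem' _ _ := trivial
  zero_mem' := trivial
  neg_mem' _ := trivial
  mul_mem' _ _ := trivial
  one_mem' := trivial
  inv_mem' _ := trivial

/-- `A` is a T-brace: every ideal of an ideal of `A` is an ideal of `A`. -/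
def IsTBrace (A : Type u) [LeftBrace A] : Prop :=
  ∀ I J : Subbrace A,
    IsIdealOf I J → IsIdealOf J (topSubbrace A) → IsIdealOf I (topSubbrace A)

/-- For an ideal `Z` of `A`, the preimage in `A` of the `⋆`-center of the quotient brace `A / Z`.
A coset `a + Z` lies in that `⋆`-center iff `(a + Z) ⋆ (x + Z) = (a ⋆ x) + Z` and
`(x + Z) ⋆ (a + Z) = (x ⋆ a) + Z` are zero for all `x`. -/
def starCenterMod {A : Type u} [LeftBrace A] (Z : Set A) : Set A :=
  {a | ∀ x : A, starMul a x ∈ Z ∧ starMul x a ∈ Z}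

/-- The upper `⋆`-central series: `ζ_0 = 0`, `ζ_{α+1} / ζ_α` is the `⋆`-center of `A / ζ_α`,
and `ζ_l` is the union of the earlier terms for a limit ordinal `l`. -/
noncomputable def upperStarCentralSeries (A : Type u) [LeftBrace A] (α : Ordinal.{u}) : Set A :=
  Ordinal.limitRecOn (motive := fun _ => Set A) α {0} (fun _ Z => starCenterMod Z)
    (fun l _ Z => ⋃ (β : Ordinal.{u}) (h : β < l), Z β h)

/-- The length `zl(A)` of the upper `⋆`-central series: the least ordinal at which the series
becomes stationary. -/
noncomputable def zl (A : Type u) [LeftBrace A] : Ordinal.{u} :=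
  sInf {α | upperStarCentralSeries A (Order.succ α) = upperStarCentralSeries A α}

end LeftBrace

/-! Write `L_i` for the lower `⋆`-central series, indexed from `L_0 = A`. Smoktunowicz-nilpotency
makes every nonzero quotient of `A` by a suitable ideal have a nonzero `⋆`-center, so the upper
series ends at `A` and `L_k = 0` (`lower_eq_bot`). For a subbrace `S`, each `S + L_{n+1}` is then an
ideal of `S + L_n`, so in a T-brace every subbrace is an ideal (`isIdealOf_top`). Consequently `d ⋆
y` and `y ⋆ d` are, modulo a suitable term of a central series, combinations of `d` and `d ⋆ d`
(`star_mem_zmultiples_sup`).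

Fix `p` and let `I_i` be the `p'`-isolator of `L_i`; these again form a central series.
Non-periodicity provides an element `a` of infinite order modulo `I_1`. If `b` has infinite order
modulo `I_1`, the coefficient of `b` in the combination must vanish, so `b ⋆ y` and `y ⋆ b` are
multiples of `b ⋆ b` modulo `I_2`. Comparing `b` with `p • b` shows that `p` kills `I_1 / I_2`, and
then every `I_{i+1} / I_{i+2}` (`nsmul_mem_isoLower`). Adding multiples of `a` to arbitrary elements
extends the argument to them and makes each of these factors cyclic (`exists_isoLower_le`). Thus
`I_1 / I_k` has order at most `p ^ (k - 1)`. A `p`-subgroup of `K ≤ I_1` meets `I_k`, which consists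
of `p'`-torsion, trivially, so it embeds in `I_1 / I_k`. -/

namespace LeftBrace

local infixl:70 " ⋆ " => starMul

/-! ### Star calculus, central factors and socles. -/

section Basic

variable {A : Type u} [LeftBrace A]

theorem one_eq_zero : (1 : A) = 0 := by
  have h := mul_add_eq (1 : A) 0 0
  simpa using h

theorem mul_eq_add_star (a b : A) : a * b = a + b + a ⋆ b := by
  unfold starMul; abel

theorem star_add (a b c : A) : a ⋆ (b + c) = a ⋆ b + a ⋆ c := by
  unfold starMul; rw [mul_add_eq]; abel

theorem star_zero (a : A) : a ⋆ 0 = 0 := by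
  simpa using star_add a 0 0

theorem zero_star (a : A) : 0 ⋆ a = 0 := by
  have h : (0 : A) * a = a := by rw [← one_eq_zero, one_mul]
  unfold starMul; rw [h]; abel

/-- The additive map `b ↦ a ⋆ b`. -/
def starLeft (a : A) : A →+ A := AddMonoidHom.mk' (fun b => a ⋆ b) (star_add a)

theorem star_neg (a b : A) : a ⋆ (-b) = -(a ⋆ b) := map_neg (starLeft a) b

theorem star_nsmul (a b : A) (n : ℕ) : a ⋆ (n • b) = n • (a ⋆ b) := map_nsmul (starLeft a) n b

theorem star_zsmul (a b : A) (n : ℤ) : a ⋆ (n • b) = n • (a ⋆ b) := map_zsmul (starLeft a) n b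

theorem mul_star (a b c : A) : (a * b) ⋆ c = a ⋆ (b ⋆ c) + b ⋆ c + a ⋆ c := by
  have h1 : a * (b * c) = a + (b + c + b ⋆ c) + (a ⋆ b + a ⋆ c + a ⋆ (b ⋆ c)) := by
    rw [mul_eq_add_star a (b * c), mul_eq_add_star b c, star_add, star_add]
  have h2 : (a * b) ⋆ c = a * (b * c) - a * b - c := by rw [← mul_assoc]; rfl
  rw [h2, h1, mul_eq_add_star a b]; abel

/-- `x + u = x * shift x u`. -/
def shift (x u : A) : A := u + x⁻¹ ⋆ u

theorem mul_shift (x u : A) : x * shift x u = x + u := by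
  have h : shift x u = x⁻¹ * (x + u) := by
    rw [mul_add_eq, inv_mul_cancel, one_eq_zero, mul_eq_add_star x⁻¹ u, shift]; abel
  rw [h, mul_inv_cancel_left]

theorem shift_add_star (x u : A) : shift x u + x ⋆ shift x u = u := by
  have h := mul_shift x u
  rw [mul_eq_add_star, add_assoc] at h
  exact add_left_cancel h

theorem inv_eq_neg_shift (x : A) : x⁻¹ = shift x (-x) := by
  have h := mul_shift x (-x)
  rw [add_neg_cancel, ← one_eq_zero] at h
  exact (eq_inv_of_mul_eq_one_right h).symm

/-- `C / D` lies in the `⋆`-center of `A / D`. -/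
structure StarCentral (C D : AddSubgroup A) : Prop where
  le : D ≤ C
  right : ∀ c ∈ C, ∀ a, c ⋆ a ∈ D
  left : ∀ c ∈ C, ∀ a, a ⋆ c ∈ D

variable {C D : AddSubgroup A}

theorem StarCentral.self (h : StarCentral C D) : StarCentral C C :=
  ⟨le_rfl, fun c hc a => h.le (h.right c hc a), fun c hc a => h.le (h.left c hc a)⟩

theorem StarCentral.shift_mem (h : StarCentral C C) {u : A} (hu : u ∈ C) (x : A) :
    shift x u ∈ C := C.add_mem hu (h.left u hu _)

/-- `⋆` is not additive on the left, but `mul_star` handles products there; `shift` turns the sum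
into a product whose second factor is still in `C`. -/
theorem StarCentral.add_star_sub_mem (h : StarCentral C D) (x : A) {u : A} (hu : u ∈ C) (y : A) :
    (x + u) ⋆ y - x ⋆ y ∈ D := by
  rw [← mul_shift, mul_star, add_sub_cancel_right]
  have h1 := h.right _ (h.self.shift_mem hu x) y
  exact D.add_mem (h.left _ (h.le h1) x) h1

theorem inv_star_mem {x : A} (hx : ∀ y, x ⋆ y ∈ C) (y : A) :
    x⁻¹ ⋆ y ∈ C := by
  have h1 := mul_star x x⁻¹ y
  rw [mul_inv_cancel, one_eq_zero, zero_star] at h1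
  have h2 : x⁻¹ ⋆ y = -(x ⋆ (x⁻¹ ⋆ y) + x ⋆ y) := by
    rw [eq_neg_iff_add_eq_zero, h1]; abel
  rw [h2]
  exact C.neg_mem (C.add_mem (hx _) (hx _))

/-- With `x + x' = x * w`, the cross term `x ⋆ (w ⋆ y)` of `mul_star` falls into `D`, and `w`
differs from `x'` by `x ⋆ w ∈ C`, which is invisible modulo `D`. -/
theorem StarCentral.star_add_sub_mem (h : StarCentral C D) {x x' : A} (hx : ∀ y, x ⋆ y ∈ C)
    (hx' : ∀ y, x' ⋆ y ∈ C) (y : A) : (x + x') ⋆ y - (x ⋆ y + x' ⋆ y) ∈ D := by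
  set w := shift x x' with hw
  have h1 : x' ⋆ y - w ⋆ y ∈ D := by
    have := h.add_star_sub_mem w (hx w) y
    rwa [hw, shift_add_star, ← hw] at this
  have h2 : w ⋆ y ∈ C := by
    have := C.sub_mem (hx' y) (h.le h1)
    rwa [sub_sub_cancel] at this
  have h3 : (x + x') ⋆ y - (x ⋆ y + x' ⋆ y) = x ⋆ (w ⋆ y) - (x' ⋆ y - w ⋆ y) := by
    rw [← mul_shift, ← hw, mul_star]; abel
  rw [h3]
  exact D.sub_mem (h.left _ h2 _) h1

/-- The preimage in `A` of the socle of `A / C`. -/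
def socleMod (h : StarCentral C C) : AddSubgroup A where
  carrier := {x | ∀ y, x ⋆ y ∈ C}
  zero_mem' y := by rw [zero_star]; exact C.zero_mem
  add_mem' {a b} ha hb y := by
    have := C.add_mem (h.star_add_sub_mem ha hb y) (C.add_mem (ha y) (hb y))
    rwa [sub_add_cancel] at this
  neg_mem' {x} hx y := by
    have h1 : -x = x⁻¹ + x ⋆ x⁻¹ := by
      have h2 := shift_add_star x (-x)
      rwa [← inv_eq_neg_shift, eq_comm] at h2
    have h3 := h.add_star_sub_mem x⁻¹ (hx x⁻¹) y
    rw [← h1] at h3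
    have := C.add_mem h3 (inv_star_mem hx y)
    rwa [sub_add_cancel] at this

/-- Left multiplication by elements of the socle modulo `C` is additive modulo `D`. -/
def starHom (h : StarCentral C D) (y : A) : socleMod h.self →+ A ⧸ D :=
  AddMonoidHom.mk' (fun x => ((x : A) ⋆ y : A)) fun a b => by
    rw [← QuotientAddGroup.mk_add]
    refine (QuotientAddGroup.eq.2 ?_).symm
    have := h.star_add_sub_mem a.2 b.2 y
    rwa [sub_eq_neg_add] at this

theorem StarCentral.zsmul_star_sub_mem (h : StarCentral C D) {x : A} (hx : ∀ y, x ⋆ y ∈ C)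
    (n : ℤ) (y : A) : (n • x) ⋆ y - n • (x ⋆ y) ∈ D := by
  have h1 := map_zsmul (starHom h y) n ⟨x, hx⟩
  have h2 : (((n • x) ⋆ y : A) : A ⧸ D) = ((n • (x ⋆ y) : A) : A ⧸ D) := h1
  rw [sub_eq_neg_add]
  exact QuotientAddGroup.eq.1 h2.symm

theorem StarCentral.star_add_mem_of_le (h : StarCentral C D) {E : AddSubgroup A} (hE : D ≤ E)
    {x x' : A} (hx : ∀ y, x ⋆ y ∈ C) (hx' : ∀ y, x' ⋆ y ∈ C) {y : A} (h1 : x ⋆ y ∈ E)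
    (h2 : x' ⋆ y ∈ E) : (x + x') ⋆ y ∈ E := by
  have := E.add_mem (hE (h.star_add_sub_mem hx hx' y)) (E.add_mem h1 h2)
  rwa [sub_add_cancel] at this

theorem StarCentral.zsmul_star_mem_of_le (h : StarCentral C D) {E : AddSubgroup A} (hE : D ≤ E)
    {x : A} (hx : ∀ y, x ⋆ y ∈ C) {y : A} (h1 : x ⋆ y ∈ E) (n : ℤ) : (n • x) ⋆ y ∈ E := by
  have := E.add_mem (hE (h.zsmul_star_sub_mem hx n y)) (E.zsmul_mem h1 n)
  rwa [sub_add_cancel] at this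

/-- The preimage in `A` of the `⋆`-center of `A / C`, as an additive subgroup. -/
def starCenterSubgroup (h : StarCentral C C) : AddSubgroup A where
  carrier := starCenterMod (C : Set A)
  zero_mem' y := by rw [zero_star, star_zero]; exact ⟨C.zero_mem, C.zero_mem⟩
  add_mem' {a b} ha hb y :=
    ⟨(socleMod h).add_mem (fun y => (ha y).1) (fun y => (hb y).1) y, by
      rw [star_add]; exact C.add_mem (ha y).2 (hb y).2⟩
  neg_mem' {a} ha y :=
    ⟨(socleMod h).neg_mem (x := a) (fun y => (ha y).1) y, by
      rw [star_neg]; exact C.neg_mem (ha y).2⟩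

theorem starCentral_starCenterSubgroup (h : StarCentral C C) :
    StarCentral (starCenterSubgroup h) C :=
  ⟨fun c hc a => ⟨h.right c hc a, h.left c hc a⟩, fun _ hc a => (hc a).1, fun _ hc a => (hc a).2⟩

/-- Modulo `C`, `y ⋆ x` is the conjugate `y * x * y⁻¹` minus `x`. The socle is the kernel of the
multiplicative group acting on `A / C`, so it contains the conjugate. -/
theorem star_mem_socleMod (h : StarCentral C C) {x : A} (hx : x ∈ socleMod h) (y : A) :
    y ⋆ x ∈ socleMod h := by
  have hlam : y ⋆ x = (y * x * y⁻¹ + -(x ⋆ y⁻¹ + y ⋆ (x ⋆ y⁻¹))) - x := by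
    have h1 : y + y⁻¹ + y ⋆ y⁻¹ = 0 := by
      rw [← mul_eq_add_star, mul_inv_cancel, one_eq_zero]
    have h2 : y⁻¹ + y ⋆ y⁻¹ = -y := by
      rw [eq_neg_iff_add_eq_zero, ← h1]; abel
    have h3 : y * x * y⁻¹ = y * x + (y⁻¹ + y ⋆ y⁻¹) + x ⋆ y⁻¹ + y ⋆ (x ⋆ y⁻¹) := by
      rw [mul_eq_add_star (y * x), mul_star]; abel
    rw [h3, h2, mul_eq_add_star y x]; abel
  rw [hlam]
  refine (socleMod h).sub_mem (fun w => ?_) hx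
  have hu : -(x ⋆ y⁻¹ + y ⋆ (x ⋆ y⁻¹)) ∈ C :=
    C.neg_mem (C.add_mem (hx _) (h.left _ (hx _) _))
  have h4 := h.add_star_sub_mem (y * x * y⁻¹) hu w
  have h5 : (y * x * y⁻¹) ⋆ w ∈ C := by
    have h6 : (y * x * y⁻¹) ⋆ w = y ⋆ (x ⋆ (y⁻¹ ⋆ w)) + x ⋆ (y⁻¹ ⋆ w) + y ⋆ (x ⋆ w) + x ⋆ w := by
      have h7 := mul_star y y⁻¹ w
      rw [mul_inv_cancel, one_eq_zero, zero_star] at h7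
      have h8 : y ⋆ (y⁻¹ ⋆ w) = -(y⁻¹ ⋆ w + y ⋆ w) := by
        rw [eq_neg_iff_add_eq_zero, h7]; abel
      rw [mul_star, mul_star, mul_star, h8]
      abel
    rw [h6]
    exact C.add_mem (C.add_mem (C.add_mem (h.left _ (hx _) _) (hx _)) (h.left _ (hx _) _)) (hx _)
  have := C.add_mem h4 h5
  rwa [sub_add_cancel] at this

end Basic

/-! ### Upper and lower central series of a nilpotent brace. -/

section Series

variable {A : Type u} [LeftBrace A]

/-- Climbing the left series back from `0` puts the socle modulo `Z` inside the `⋆`-center modulo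
`Z`, hence inside `Z`. Climbing the right series back then puts all of `A` inside `Z`. -/
theorem eq_top_of_starCenterSubgroup_le (hS : IsSmoktunowiczNilpotent A) {Z : AddSubgroup A}
    (h : StarCentral Z Z) (hZ : starCenterSubgroup h ≤ Z) : Z = ⊤ := by
  obtain ⟨n, m, hn, hm⟩ := hS
  have hsoc : socleMod h ≤ Z := by
    have key : ∀ i j, i + j = m → socleMod h ⊓ leftSeries A j ≤ Z := by
      intro i
      induction i with
      | zero =>
        intro j hj
        obtain rfl : j = m := by omega
        rw [hm, inf_bot_eq]
        exact bot_le
      | succ i ih =>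
        intro j hj x hx
        refine hZ fun y => ⟨hx.1 y, ih (j + 1) (by omega) ⟨star_mem_socleMod h hx.1 y, ?_⟩⟩
        exact AddSubgroup.subset_closure ⟨y, trivial, x, hx.2, rfl⟩
    intro x hx
    exact key m 0 rfl ⟨hx, trivial⟩
  have key : ∀ i j, i + j = n → rightSeries A j ≤ Z := by
    intro i
    induction i with
    | zero =>
      intro j hj
      obtain rfl : j = n := by omega
      rw [hn]
      exact bot_le
    | succ i ih =>
      intro j hj x hx
      refine hsoc fun y => ih (j + 1) (by omega) ?_
      exact AddSubgroup.subset_closure ⟨x, hx, y, trivial, rfl⟩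
  exact top_le_iff.1 (key n 0 rfl)

/-- The lower `⋆`-central series: `L₀ = A`, and `Lₙ₊₁` is generated by `Lₙ ⋆ A` and `A ⋆ Lₙ`. -/
def lowerStarCentralSeries (A : Type u) [LeftBrace A] : ℕ → AddSubgroup A
  | 0 => ⊤
  | n + 1 => AddSubgroup.closure
      {z | ∃ x ∈ lowerStarCentralSeries A n, ∃ y, z = x ⋆ y ∨ z = y ⋆ x}

theorem star_mem_lower {n : ℕ} {x : A} (hx : x ∈ lowerStarCentralSeries A n) (y : A) :
    x ⋆ y ∈ lowerStarCentralSeries A (n + 1) :=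
  AddSubgroup.subset_closure ⟨x, hx, y, Or.inl rfl⟩

theorem star_mem_lower' {n : ℕ} {x : A} (hx : x ∈ lowerStarCentralSeries A n) (y : A) :
    y ⋆ x ∈ lowerStarCentralSeries A (n + 1) :=
  AddSubgroup.subset_closure ⟨x, hx, y, Or.inr rfl⟩

theorem lower_succ_le_iff {n : ℕ} {E : AddSubgroup A} :
    lowerStarCentralSeries A (n + 1) ≤ E ↔
      ∀ x ∈ lowerStarCentralSeries A n, ∀ y, x ⋆ y ∈ E ∧ y ⋆ x ∈ E := by
  refine ⟨fun h x hx y => ⟨h (star_mem_lower hx y), h (star_mem_lower' hx y)⟩, fun h => ?_⟩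
  refine (AddSubgroup.closure_le E).2 ?_
  rintro z ⟨x, hx, y, rfl | rfl⟩
  exacts [(h x hx y).1, (h x hx y).2]

theorem lower_succ_le (n : ℕ) : lowerStarCentralSeries A (n + 1) ≤ lowerStarCentralSeries A n := by
  induction n with
  | zero => exact le_top
  | succ n ih =>
    exact lower_succ_le_iff.2 fun x hx y => ⟨star_mem_lower (ih hx) y, star_mem_lower' (ih hx) y⟩

theorem starCentral_lower (n : ℕ) :
    StarCentral (lowerStarCentralSeries A n) (lowerStarCentralSeries A (n + 1)) :=
  ⟨lower_succ_le n, fun _ hc a => star_mem_lower hc a, fun _ hc a => star_mem_lower' hc a⟩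

theorem upper_zero : upperStarCentralSeries A 0 = {0} := by
  simp [upperStarCentralSeries]

theorem upper_succ (α : Ordinal.{u}) :
    upperStarCentralSeries A (Order.succ α) = starCenterMod (upperStarCentralSeries A α) := by
  unfold upperStarCentralSeries
  rw [Order.succ_eq_add_one]
  exact Ordinal.limitRecOn_add_one ..

theorem exists_subgroup_upper (n : ℕ) :
    ∃ Z : AddSubgroup A, StarCentral Z Z ∧ (Z : Set A) = upperStarCentralSeries A n := by
  induction n with
  | zero =>
    refine ⟨⊥, ⟨le_rfl, ?_, ?_⟩, by rw [Nat.cast_zero, upper_zero]; rfl⟩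
    · rintro c rfl a; exact zero_star a
    · rintro c rfl a; exact star_zero a
  | succ n ih =>
    obtain ⟨Z, hZ, h⟩ := ih
    refine ⟨starCenterSubgroup hZ, (starCentral_starCenterSubgroup hZ).self, ?_⟩
    rw [Nat.cast_succ, ← Order.succ_eq_add_one, upper_succ, ← h]
    rfl

theorem upper_eq_univ (hS : IsSmoktunowiczNilpotent A) {k : ℕ} (hk : 0 < k)
    (hzl : zl A = (k : Ordinal.{u})) : upperStarCentralSeries A (k : Ordinal.{u}) = Set.univ := by
  have hne : {α : Ordinal.{u} |
      upperStarCentralSeries A (Order.succ α) = upperStarCentralSeries A α}.Nonempty := by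
    -- The infimum of the empty set of ordinals is `0`, which `0 < k` excludes.
    by_contra hne
    rw [Set.not_nonempty_iff_eq_empty] at hne
    rw [zl, hne, Ordinal.sInf_empty] at hzl
    exact hk.ne (by exact_mod_cast hzl)
  have hmem := csInf_mem hne
  change zl A ∈ _ at hmem
  rw [hzl, Set.mem_ofPred_eq, upper_succ] at hmem
  obtain ⟨Z, hZ, h⟩ := exists_subgroup_upper (A := A) k
  rw [← h] at hmem ⊢
  rw [eq_top_of_starCenterSubgroup_le hS hZ fun x hx => ?_]
  · rfl
  · exact hmem.subset hx

theorem lower_subset_upper {k : ℕ} (hk : upperStarCentralSeries A (k : Ordinal.{u}) = Set.univ)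
    (i j : ℕ) (hij : i + j = k) :
    (lowerStarCentralSeries A i : Set A) ⊆ upperStarCentralSeries A (j : Ordinal.{u}) := by
  induction i generalizing j with
  | zero =>
    obtain rfl : j = k := by omega
    rw [hk]
    exact Set.subset_univ _
  | succ i ih =>
    have h1 := ih (j + 1) (by omega)
    rw [Nat.cast_succ, ← Order.succ_eq_add_one, upper_succ] at h1
    obtain ⟨Z, hZ, h⟩ := exists_subgroup_upper (A := A) j
    rw [← h] at h1 ⊢
    exact lower_succ_le_iff.2 fun x hx y => h1 hx y

theorem lower_eq_bot (hS : IsSmoktunowiczNilpotent A) {k : ℕ} (hk : 0 < k)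
    (hzl : zl A = (k : Ordinal.{u})) : lowerStarCentralSeries A k = ⊥ := by
  have h := lower_subset_upper (upper_eq_univ hS hk hzl) k 0 rfl
  rw [Nat.cast_zero, upper_zero] at h
  exact (AddSubgroup.eq_bot_iff_forall _).2 fun x hx => h hx

/-! ### Every subbrace is an ideal. -/

/-- An additive subgroup closed under `⋆` between two consecutive terms of a central series is a
subbrace. -/
def subbraceOfStarClosed {C D : AddSubgroup A} (h : StarCentral C D) (S : AddSubgroup A)
    (hD : D ≤ S) (hC : ∀ x ∈ S, ∀ y, x ⋆ y ∈ C) (hS : ∀ x ∈ S, ∀ y ∈ S, x ⋆ y ∈ S) :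
    Subbrace A where
  toAddSubgroup := S
  mul_mem' {a b} ha hb := by
    change a * b ∈ S
    rw [mul_eq_add_star]
    exact S.add_mem (S.add_mem ha hb) (hS a ha b hb)
  one_mem' := by
    change (1 : A) ∈ S
    rw [one_eq_zero]
    exact S.zero_mem
  inv_mem' {x} hx := by
    change x ∈ S at hx
    change x⁻¹ ∈ S
    have h1 := mul_star x⁻¹ x x
    rw [inv_mul_cancel, one_eq_zero, zero_star] at h1
    have h2 : x⁻¹ = -x + (x⁻¹ ⋆ (x ⋆ x) + x ⋆ x) := by
      have h3 : x⁻¹ ⋆ x = -(x⁻¹ ⋆ (x ⋆ x) + x ⋆ x) := by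
        rw [eq_neg_iff_add_eq_zero, h1]; abel
      nth_rewrite 1 [inv_eq_neg_shift]
      rw [shift, star_neg, h3, neg_neg]
    rw [h2]
    exact S.add_mem (S.neg_mem hx) (S.add_mem (hD (h.left _ (hC x hx x) _)) (hS x hx x hx))

theorem star_mem_sup (S : Subbrace A) {C D : AddSubgroup A} (h : StarCentral C D) {x y : A}
    (hx : x ∈ S.toAddSubgroup ⊔ C) (hy : y ∈ S.toAddSubgroup ⊔ C) :
    x ⋆ y ∈ S.toAddSubgroup ⊔ D := by
  obtain ⟨s, hs, l, hl, rfl⟩ := AddSubgroup.mem_sup.1 hx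
  obtain ⟨s', hs', l', hl', rfl⟩ := AddSubgroup.mem_sup.1 hy
  have h1 : s ⋆ s' ∈ S.toAddSubgroup :=
    S.toAddSubgroup.sub_mem (S.toAddSubgroup.sub_mem (S.mul_mem' hs hs') hs) hs'
  have h2 : (s + l) ⋆ (s' + l') = s ⋆ s' + (((s + l) ⋆ s' - s ⋆ s') + (s + l) ⋆ l') := by
    rw [star_add]; abel
  rw [h2]
  exact AddSubgroup.add_mem_sup h1 (D.add_mem (h.add_star_sub_mem s hl s') (h.left _ hl' _))

/-- The subbrace `S + I` for a subbrace `S` and an ideal `I`. -/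
def subbraceSup (S : Subbrace A) {I : AddSubgroup A} (h : StarCentral I I) : Subbrace A where
  toAddSubgroup := S.toAddSubgroup ⊔ I
  mul_mem' {a b} ha hb := by
    change a ∈ S.toAddSubgroup ⊔ I at ha
    change b ∈ S.toAddSubgroup ⊔ I at hb
    change a * b ∈ S.toAddSubgroup ⊔ I
    rw [mul_eq_add_star]
    exact add_mem (add_mem ha hb) (star_mem_sup S h ha hb)
  one_mem' := by
    change (1 : A) ∈ S.toAddSubgroup ⊔ I
    rw [one_eq_zero]
    exact zero_mem _
  inv_mem' {x} hx := by
    change x ∈ S.toAddSubgroup ⊔ I at hx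
    change x⁻¹ ∈ S.toAddSubgroup ⊔ I
    obtain ⟨s, hs, l, hl, rfl⟩ := AddSubgroup.mem_sup.1 hx
    have hl' := h.shift_mem hl s
    have hl'' : (shift s l)⁻¹ ∈ I := by
      rw [inv_eq_neg_shift]
      exact h.shift_mem (I.neg_mem hl') _
    rw [← mul_shift, mul_inv_rev, mul_eq_add_star, add_right_comm, add_comm]
    exact AddSubgroup.add_mem_sup (S.inv_mem' hs) (I.add_mem hl'' (h.right _ hl'' _))

/-- The chain `S + L_n` descends from `A` to `S`, each term an ideal of the one before; the
T-property is applied once per link. -/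
theorem isIdealOf_top (hT : IsTBrace A) {k : ℕ} (hk : lowerStarCentralSeries A k = ⊥)
    (S : Subbrace A) : IsIdealOf S (topSubbrace A) := by
  have key : ∀ n, IsIdealOf (subbraceSup S (starCentral_lower n).self) (topSubbrace A) := by
    intro n
    induction n with
    | zero =>
      have h : ∀ x : A, x ∈ S.toAddSubgroup ⊔ lowerStarCentralSeries A 0 := fun x =>
        (le_sup_right : lowerStarCentralSeries A 0 ≤ _) trivial
      exact ⟨fun _ _ => trivial, fun b _ z _ => ⟨h _, h _⟩⟩
    | succ n ih =>
      refine hT _ _ ⟨?_, fun b hb z hz => ?_⟩ ih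
      · exact sup_le_sup_left (lower_succ_le n) S.toAddSubgroup
      · have hz' := sup_le_sup_left (lower_succ_le n) S.toAddSubgroup hz
        exact ⟨star_mem_sup S (starCentral_lower n) hb hz',
          star_mem_sup S (starCentral_lower n) hz' hb⟩
  have h := key k
  have hS : (subbraceSup S (starCentral_lower k).self).carrier = S.carrier := by
    change ((S.toAddSubgroup ⊔ lowerStarCentralSeries A k : AddSubgroup A) : Set A) = S.carrier
    rw [hk, sup_bot_eq]
    rfl
  unfold IsIdealOf at h
  rwa [hS] at h

/-- Every subbrace is an ideal, so `d ⋆ y` and `y ⋆ d` lie in the subbrace generated by `d`. -/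
theorem star_mem_zmultiples_sup (hI : ∀ S : Subbrace A, IsIdealOf S (topSubbrace A))
    {C D : AddSubgroup A} (h : StarCentral C D) {d : A} (hd : ∀ y, d ⋆ y ∈ C) (y : A) :
    d ⋆ y ∈ AddSubgroup.zmultiples d ⊔ (AddSubgroup.zmultiples (d ⋆ d) ⊔ D) ∧
    y ⋆ d ∈ AddSubgroup.zmultiples d ⊔ (AddSubgroup.zmultiples (d ⋆ d) ⊔ D) := by
  set E := AddSubgroup.zmultiples (d ⋆ d) ⊔ D with hE
  set S := AddSubgroup.zmultiples d ⊔ E with hS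
  have hDE : D ≤ E := le_sup_right
  have hES : E ≤ S := le_sup_right
  have hdE : d ⋆ d ∈ E := (le_sup_left : _ ≤ E) (AddSubgroup.mem_zmultiples _)
  have hdS : d ∈ S := (le_sup_left : _ ≤ S) (AddSubgroup.mem_zmultiples _)
  have hEC : E ≤ C := sup_le (by simpa using hd d) h.le
  have hSC : S ≤ socleMod h.self :=
    sup_le (by simpa using show d ∈ socleMod h.self from hd)
      fun x hx y => h.self.right x (hEC hx) y
  have hdy : ∀ y ∈ S, d ⋆ y ∈ E := by
    have : S ≤ E.comap (starLeft d) :=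
      sup_le (AddSubgroup.zmultiples_le.2 hdE) fun x hx => hDE (h.left _ (hEC hx) _)
    exact this
  -- Modulo `D`, left multiplication by elements of `S` is additive and `E ≤ C` acts as zero, so
  -- only multiples of `d` on the left matter.
  have hxy : ∀ x ∈ S, ∀ y ∈ S, x ⋆ y ∈ S := by
    intro x hx y hy
    obtain ⟨s, hs, e, he, rfl⟩ := AddSubgroup.mem_sup.1 hx
    obtain ⟨n, rfl⟩ := AddSubgroup.mem_zmultiples_iff.1 hs
    refine hES (h.star_add_mem_of_le hDE ((socleMod h.self).zsmul_mem hd n)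
      (hSC (hES he)) ?_ (hDE (h.right _ (hEC he) _)))
    exact h.zsmul_star_mem_of_le hDE hd (hdy y hy) n
  have := (hI (subbraceOfStarClosed h S (hDE.trans hES) hSC hxy)).2 y trivial d hdS
  exact ⟨this.2, this.1⟩

end Series

/-! ### Isolators of the lower series. -/

section Isolator

/-- The elements of which some multiple by an element of `N` lies in `H`. -/
def isolator {A : Type u} [AddCommGroup A] (N : Submonoid ℕ) (H : AddSubgroup A) :
    AddSubgroup A where
  carrier := {x | ∃ m ∈ N, m • x ∈ H}
  zero_mem' := ⟨1, N.one_mem, by rw [smul_zero]; exact H.zero_mem⟩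
  add_mem' := by
    rintro a b ⟨m, hm, ha⟩ ⟨n, hn, hb⟩
    refine ⟨m * n, N.mul_mem hm hn, ?_⟩
    rw [smul_add, mul_comm m n, mul_smul, mul_comm n m, mul_smul]
    exact H.add_mem (H.nsmul_mem ha n) (H.nsmul_mem hb m)
  neg_mem' := by
    rintro a ⟨m, hm, ha⟩
    exact ⟨m, hm, by rw [smul_neg]; exact H.neg_mem ha⟩

theorem le_isolator {A : Type u} [AddCommGroup A] (N : Submonoid ℕ) (H : AddSubgroup A) :
    H ≤ isolator N H :=
  fun _ hx => ⟨1, N.one_mem, by rwa [one_smul]⟩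

theorem isolator_mono {A : Type u} [AddCommGroup A] (N : Submonoid ℕ) {H K : AddSubgroup A}
    (h : H ≤ K) : isolator N H ≤ isolator N K :=
  fun _ ⟨m, hm, hx⟩ => ⟨m, hm, h hx⟩

theorem mem_isolator_of_nsmul_mem {A : Type u} [AddCommGroup A] {N : Submonoid ℕ}
    {H : AddSubgroup A} {m : ℕ} (hm : m ∈ N) {x : A} (h : m • x ∈ isolator N H) :
    x ∈ isolator N H := by
  obtain ⟨n, hn, h⟩ := h
  exact ⟨n * m, N.mul_mem hn hm, by rwa [mul_smul]⟩

variable {A : Type u} [LeftBrace A]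

theorem pow_sub_nsmul_mem_lower {i : ℕ} {x : A} (hx : x ∈ lowerStarCentralSeries A i) (n : ℕ) :
    x ^ n - n • x ∈ lowerStarCentralSeries A (i + 1) := by
  induction n with
  | zero => simp [one_eq_zero, zero_mem]
  | succ n ih =>
    have h : x ^ (n + 1) - (n + 1) • x = (x ^ n - n • x) + x ^ n ⋆ x := by
      rw [pow_succ, mul_eq_add_star, succ_nsmul]; abel
    rw [h]
    exact add_mem ih (star_mem_lower' hx _)

theorem nsmul_pow_mem {H : AddSubgroup A} (hH : ∀ x ∈ H, ∀ y, y ⋆ x ∈ H) {m : ℕ} {x : A}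
    (hx : m • x ∈ H) (n : ℕ) : m • x ^ n ∈ H := by
  induction n with
  | zero => simp [one_eq_zero, zero_mem]
  | succ n ih =>
    rw [pow_succ', mul_eq_add_star, smul_add, smul_add, ← star_nsmul]
    exact add_mem (add_mem hx ih) (hH _ ih _)

/-- Powers and multiples agree modulo the next term, so raising to the `m`-th power once per level
pushes `x` down to `L_i`. Powers are needed since `mul_star` controls products on the left of `⋆`.
-/
theorem exists_pow_mem_lower {N : Submonoid ℕ} {i : ℕ} {x : A}
    (hx : x ∈ isolator N (lowerStarCentralSeries A i)) :
    ∃ n ∈ N, x ^ n ∈ lowerStarCentralSeries A i := by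
  obtain ⟨m, hm, hx⟩ := hx
  have hH : ∀ x ∈ lowerStarCentralSeries A i, ∀ y, y ⋆ x ∈ lowerStarCentralSeries A i :=
    (starCentral_lower i).self.left
  have key : ∀ j ≤ i, ∃ n ∈ N, x ^ n ∈ lowerStarCentralSeries A j := by
    intro j
    induction j with
    | zero => exact fun _ => ⟨1, N.one_mem, trivial⟩
    | succ j ih =>
      intro hj
      obtain ⟨n, hn, h⟩ := ih (by omega)
      refine ⟨n * m, N.mul_mem hn hm, ?_⟩
      have h1 := pow_sub_nsmul_mem_lower h m
      have h2 : m • x ^ n ∈ lowerStarCentralSeries A (j + 1) :=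
        antitone_nat_of_succ_le lower_succ_le hj (nsmul_pow_mem hH hx n)
      have := add_mem h1 h2
      rwa [sub_add_cancel, ← pow_mul] at this
  exact key i le_rfl

theorem star_mem_isolator {N : Submonoid ℕ} {i : ℕ} {x : A}
    (hx : x ∈ isolator N (lowerStarCentralSeries A i)) (y : A) :
    y ⋆ x ∈ isolator N (lowerStarCentralSeries A (i + 1)) := by
  obtain ⟨m, hm, hx⟩ := hx
  exact ⟨m, hm, by rw [← star_nsmul]; exact star_mem_lower' hx y⟩

/-- Descent on the level `j`: if all `x ⋆ y` lie in the isolator of `L_j`, then `x ^ n ⋆ y` is `n •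
(x ⋆ y)` modulo the isolator of `L_{j+1}`, and for `n = m` the former already lies there. -/
theorem isolator_star_mem {N : Submonoid ℕ} {i : ℕ} {x : A}
    (hx : x ∈ isolator N (lowerStarCentralSeries A i)) (y : A) :
    x ⋆ y ∈ isolator N (lowerStarCentralSeries A (i + 1)) := by
  obtain ⟨m, hm, hx⟩ := exists_pow_mem_lower hx
  have key : ∀ j ≤ i + 1, ∀ y, x ⋆ y ∈ isolator N (lowerStarCentralSeries A j) := by
    intro j
    induction j with
    | zero => exact fun _ y => le_isolator N _ trivial
    | succ j ih =>
      intro hj y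
      have ih := ih (by omega)
      have h1 : ∀ n : ℕ, ∀ y, x ^ n ⋆ y - n • (x ⋆ y) ∈
          isolator N (lowerStarCentralSeries A (j + 1)) := by
        intro n
        induction n with
        | zero =>
          intro y
          rw [pow_zero, one_eq_zero, zero_star, zero_smul, sub_zero]
          exact zero_mem _
        | succ n ihn =>
          intro y
          have h2 : x ^ n ⋆ y ∈ isolator N (lowerStarCentralSeries A j) := by
            have := add_mem (isolator_mono N (lower_succ_le j) (ihn y)) (nsmul_mem (ih y) n)
            rwa [sub_add_cancel] at this
          have h3 : x ^ (n + 1) ⋆ y - (n + 1) • (x ⋆ y) =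
              x ⋆ (x ^ n ⋆ y) + (x ^ n ⋆ y - n • (x ⋆ y)) := by
            rw [pow_succ', mul_star, succ_nsmul]; abel
          rw [h3]
          exact add_mem (star_mem_isolator h2 x) (ihn y)
      have h4 : x ^ m ⋆ y ∈ isolator N (lowerStarCentralSeries A (j + 1)) :=
        le_isolator N _ (antitone_nat_of_succ_le lower_succ_le hj (star_mem_lower hx y))
      have := sub_mem h4 (h1 m y)
      rw [sub_sub_cancel] at this
      exact mem_isolator_of_nsmul_mem hm this
  exact key (i + 1) le_rfl y

theorem starCentral_isolator (N : Submonoid ℕ) (i : ℕ) :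
    StarCentral (isolator N (lowerStarCentralSeries A i))
      (isolator N (lowerStarCentralSeries A (i + 1))) :=
  ⟨isolator_mono N (lower_succ_le i), fun _ hc a => isolator_star_mem hc a,
    fun _ hc a => star_mem_isolator hc a⟩

/-- If `A` is not periodic, then neither is `A / (A ⋆ A)`. -/
theorem exists_nsmul_notMem_lower_one {k : ℕ} (hk : lowerStarCentralSeries A k = ⊥)
    (hA : ¬ IsAddTorsion A) :
    ∃ a : A, ∀ n : ℕ, n ≠ 0 → n • a ∉ lowerStarCentralSeries A 1 := by
  by_contra! h
  set N := nonZeroDivisors ℕ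
  -- If `A / L_1` is periodic, periodicity passes down to every `A / L_i`, and finally to `A`
  -- itself.
  have key : ∀ i, isolator N (lowerStarCentralSeries A i) = ⊤ := by
    have h1 : isolator N (lowerStarCentralSeries A 1) = ⊤ := by
      refine (AddSubgroup.eq_top_iff' _).2 fun a => ?_
      obtain ⟨n, hn, ha⟩ := h a
      exact ⟨n, mem_nonZeroDivisors_of_ne_zero hn, ha⟩
    intro i
    induction i with
    | zero => exact top_le_iff.1 (le_isolator N _)
    | succ i ih =>
      have h2 : ∀ x y : A, x ⋆ y ∈ isolator N (lowerStarCentralSeries A (i + 1)) := fun x y =>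
        isolator_star_mem (by rw [ih]; trivial) y
      refine (AddSubgroup.eq_top_iff' _).2 fun a => ?_
      obtain ⟨n, hn, ha⟩ := h a
      refine mem_isolator_of_nsmul_mem (mem_nonZeroDivisors_of_ne_zero hn) ?_
      exact lower_succ_le_iff.2 (fun x _ y => ⟨h2 x y, h2 y x⟩) ha
  refine hA fun a => ?_
  have ha : a ∈ isolator N (lowerStarCentralSeries A k) := by rw [key k]; trivial
  obtain ⟨n, hn, ha⟩ := ha
  rw [hk, AddSubgroup.mem_bot] at ha
  exact isOfFinAddOrder_iff_nsmul_eq_zero.2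
    ⟨n, Nat.pos_of_ne_zero (nonZeroDivisors.ne_zero hn), ha⟩

end Isolator

/-! ### Cyclic values of biadditive maps and `p'`-isolators. -/

section PrimeExponent

/-- In a group of exponent `p`, a nonzero multiple of `d` generates the same subgroup as `d`. -/
theorem mem_zmultiples_of_prime {Q : Type u} [AddCommGroup Q] {p : ℕ} (hp : p.Prime) {c d : Q}
    (hd : p • d = 0) (hc : c ∈ AddSubgroup.zmultiples d) (h0 : c ≠ 0) :
    d ∈ AddSubgroup.zmultiples c := by
  obtain ⟨n, rfl⟩ := AddSubgroup.mem_zmultiples_iff.1 hc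
  have hn : IsCoprime (p : ℤ) n := by
    refine (Nat.prime_iff_prime_int.1 hp).coprime_iff_not_dvd.2 ?_
    rintro ⟨m, rfl⟩
    apply h0
    rw [mul_comm, mul_smul, natCast_zsmul, hd, smul_zero]
  obtain ⟨u, v, h⟩ := hn
  refine AddSubgroup.mem_zmultiples_iff.2 ⟨v, ?_⟩
  rw [← mul_smul]
  have h1 : v * n = 1 - u * p := by linarith
  rw [h1, sub_smul, one_smul, mul_smul, natCast_zsmul, hd, smul_zero, sub_zero]

/-- A biadditive map with values of order `p` such that each `β x y` is a multiple both of `β x x`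
and of `β y y` has all its values in one cyclic group. -/
theorem exists_zmultiples_of_biadditive {A Q : Type u} [AddCommGroup A] [AddCommGroup Q] {p : ℕ}
    (hp : p.Prime) (β : A →+ A →+ Q) (hβ : ∀ x y, p • β x y = 0)
    (h : ∀ x y, β x y ∈ AddSubgroup.zmultiples (β x x) ∧
      β x y ∈ AddSubgroup.zmultiples (β y y)) :
    ∃ a, ∀ x y, β x y ∈ AddSubgroup.zmultiples (β a a) := by
  suffices hd : ∃ a, ∀ b, β b b ∈ AddSubgroup.zmultiples (β a a) by
    obtain ⟨a, ha⟩ := hd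
    exact ⟨a, fun x y => AddSubgroup.zmultiples_le.2 (ha x) (h x y).1⟩
  by_cases h0 : ∀ a, β a a = 0
  · exact ⟨0, fun b => by rw [h0 b]; exact zero_mem _⟩
  push Not at h0
  obtain ⟨a, ha⟩ := h0
  refine ⟨a, fun b => ?_⟩
  by_cases hab : β a b = 0
  · by_cases hba : β b a = 0
    -- `β a (a + b) = β a a` is a nonzero multiple of `β a a + β b b`, so the two generate the same
    -- group.
    · have h1 : β (a + b) (a + b) = β a a + β b b := by simp [hab, hba]
      have h2 : β a (a + b) = β a a := by simp [hab]
      have h3 := (h a (a + b)).2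
      rw [h2, h1] at h3
      have h4 := mem_zmultiples_of_prime hp
        (by rw [smul_add, hβ, hβ, add_zero]) h3 ha
      have := sub_mem h4 (AddSubgroup.mem_zmultiples (β a a))
      rwa [add_sub_cancel_left] at this
    · exact AddSubgroup.zmultiples_le.2 (h b a).2
        (mem_zmultiples_of_prime hp (hβ _ _) (h b a).1 hba)
  · exact AddSubgroup.zmultiples_le.2 (h a b).1
      (mem_zmultiples_of_prime hp (hβ _ _) (h a b).2 hab)

/-- The natural numbers coprime to `p`. -/
def coprimeTo (p : ℕ) : Submonoid ℕ where
  carrier := {m | m.Coprime p}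
  mul_mem' ha hb := Nat.Coprime.mul_left ha hb
  one_mem' := Nat.coprime_one_left p

theorem mem_isolator_of_zsmul_mem {A : Type u} [AddCommGroup A] {p : ℕ} {H : AddSubgroup A} {n : ℤ}
    (hn : IsCoprime n p) {x : A} (h : n • x ∈ isolator (coprimeTo p) H) :
    x ∈ isolator (coprimeTo p) H := by
  refine mem_isolator_of_nsmul_mem (m := n.natAbs) (Int.isCoprime_iff_gcd_eq_one.1 hn) ?_
  rcases Int.natAbs_eq n with h1 | h1 <;> rw [h1] at h
  · rwa [natCast_zsmul] at h
  · rwa [neg_smul, natCast_zsmul, neg_mem_iff] at h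

/-- Bézout: `x` is a combination of `m • x ∈ H` and `p • x ∈ E`. -/
theorem isolator_le {A : Type u} [AddCommGroup A] {p : ℕ} {H E : AddSubgroup A} (hH : H ≤ E)
    (hp : ∀ x ∈ isolator (coprimeTo p) H, p • x ∈ E) : isolator (coprimeTo p) H ≤ E := by
  intro x hx
  have h1 := hp x hx
  obtain ⟨m, hm, hx⟩ := hx
  obtain ⟨u, v, h⟩ := (Nat.isCoprime_iff_coprime.2 hm : IsCoprime (m : ℤ) p)
  have h2 : x = u • (m • x) + v • (p • x) := by
    rw [← natCast_zsmul, ← natCast_zsmul, ← mul_smul, ← mul_smul, ← add_smul, h, one_smul]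
  rw [h2]
  exact add_mem (zsmul_mem (hH hx) u) (zsmul_mem h1 v)

variable {A : Type u} [LeftBrace A]

/-- The `p'`-isolators of the terms of the lower `⋆`-central series. -/
def isoLower (A : Type u) [LeftBrace A] (p i : ℕ) : AddSubgroup A :=
  isolator (coprimeTo p) (lowerStarCentralSeries A i)

theorem starCentral_isoLower (p i : ℕ) : StarCentral (isoLower A p i) (isoLower A p (i + 1)) :=
  starCentral_isolator _ i

theorem isoLower_antitone (p : ℕ) : Antitone (isoLower A p) :=
  antitone_nat_of_succ_le fun i => (starCentral_isoLower p i).le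

theorem isoLower_succ_le {p i : ℕ} {E : AddSubgroup A}
    (hE : ∀ x ∈ isoLower A p i, ∀ y, x ⋆ y ∈ E ∧ y ⋆ x ∈ E)
    (hp : ∀ x ∈ isoLower A p (i + 1), p • x ∈ E) : isoLower A p (i + 1) ≤ E :=
  isolator_le (lower_succ_le_iff.2 fun x hx => hE x (le_isolator _ _ hx)) hp

theorem mem_isoLower_zero (p : ℕ) (x : A) : x ∈ isoLower A p 0 := le_isolator _ _ trivial

theorem exists_nsmul_notMem_isoLower_one {p k : ℕ} (hp : p.Prime)
    (hk : lowerStarCentralSeries A k = ⊥) (hA : ¬ IsAddTorsion A) :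
    ∃ a : A, ∀ n : ℤ, n ≠ 0 → n • a ∉ isoLower A p 1 := by
  obtain ⟨a, ha⟩ := exists_nsmul_notMem_lower_one hk hA
  refine ⟨a, fun n hn ⟨m, hm, h⟩ => ?_⟩
  have hm0 : m ≠ 0 := by
    rintro rfl
    exact hp.one_lt.ne' ((Nat.coprime_zero_left p).1 hm)
  refine ha (m * n.natAbs) (mul_ne_zero hm0 (Int.natAbs_ne_zero.2 hn)) ?_
  rcases Int.natAbs_eq n with h1 | h1 <;> rw [h1] at h
  · rwa [natCast_zsmul, ← mul_smul] at h
  · rwa [neg_smul, natCast_zsmul, smul_neg, neg_mem_iff, ← mul_smul] at h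

/-! ### The factors of the isolator series have exponent `p`. -/

/-- The biadditive map induced by `⋆` modulo the second term of the series. -/
def starBihom (A : Type u) [LeftBrace A] (p : ℕ) : A →+ A →+ A ⧸ isoLower A p 2 :=
  AddMonoidHom.mk' (fun x => (QuotientAddGroup.mk' _).comp (starLeft x)) fun a b => by
    ext y
    have h1 := fun x y => (starCentral_isoLower p 0).right x (mem_isoLower_zero (A := A) p x) y
    have := (starCentral_isoLower p 1).star_add_sub_mem (h1 a) (h1 b) y
    rw [sub_eq_neg_add] at this
    exact (QuotientAddGroup.eq.2 this).symm

/-- Star products lie in `I_1`, where no nonzero multiple of `b` lies, so the `b`-part of the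
combination vanishes. -/
theorem mem_zmultiples_starBihom {p : ℕ} (hI : ∀ S : Subbrace A, IsIdealOf S (topSubbrace A))
    {b : A} (hb : ∀ n : ℤ, n ≠ 0 → n • b ∉ isoLower A p 1) (y : A) :
    starBihom A p b y ∈ AddSubgroup.zmultiples (starBihom A p b b) ∧
    starBihom A p y b ∈ AddSubgroup.zmultiples (starBihom A p b b) := by
  have h0 := fun x y => (starCentral_isoLower p 0).right x (mem_isoLower_zero (A := A) p x) y
  have key : ∀ w ∈ isoLower A p 1,
      w ∈ AddSubgroup.zmultiples b ⊔ (AddSubgroup.zmultiples (b ⋆ b) ⊔ isoLower A p 2) →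
      (w : A ⧸ isoLower A p 2) ∈ AddSubgroup.zmultiples (starBihom A p b b) := by
    intro w hw hw'
    obtain ⟨_, h1, e, he, rfl⟩ := AddSubgroup.mem_sup.1 hw'
    obtain ⟨s, rfl⟩ := AddSubgroup.mem_zmultiples_iff.1 h1
    have he1 : e ∈ isoLower A p 1 :=
      (sup_le (AddSubgroup.zmultiples_le.2 (h0 b b)) (starCentral_isoLower p 1).le) he
    have hs : s = 0 := by
      by_contra hs
      exact hb s hs ((AddSubgroup.add_mem_cancel_right _ he1).1 hw)
    rw [hs, zero_smul, zero_add]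
    obtain ⟨_, h2, m, hm, rfl⟩ := AddSubgroup.mem_sup.1 he
    obtain ⟨t, rfl⟩ := AddSubgroup.mem_zmultiples_iff.1 h2
    rw [QuotientAddGroup.mk_add, (QuotientAddGroup.eq_zero_iff m).2 hm, add_zero]
    exact AddSubgroup.mem_zmultiples_iff.2 ⟨t, rfl⟩
  have := star_mem_zmultiples_sup hI (starCentral_isoLower p 1) (h0 b) y
  exact ⟨key _ (h0 b y) this.1, key _ (h0 y b) this.2⟩

theorem starBihom_torsion {p : ℕ} (hp : p.Prime)
    (hI : ∀ S : Subbrace A, IsIdealOf S (topSubbrace A))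
    {a : A} (ha : ∀ n : ℤ, n ≠ 0 → n • a ∉ isoLower A p 1) (x y : A) :
    p • starBihom A p x y = 0 := by
  have hinf : ∀ b : A, (∀ n : ℤ, n ≠ 0 → n • b ∉ isoLower A p 1) → ∀ y,
      p • starBihom A p b y = 0 := by
    intro b hb y
    -- For `p • b`, the product `p • β b b` becomes a multiple `t * p ^ 2` of `β b b`. Hence `1 - t
    -- * p`, which is prime to `p`, kills `p • β b b`, and `I_2` is `p'`-isolated.
    have hpb : ∀ n : ℤ, n ≠ 0 → n • (p • b) ∉ isoLower A p 1 := by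
      intro n hn
      rw [← natCast_zsmul, ← mul_smul]
      exact hb _ (mul_ne_zero hn (by exact_mod_cast hp.ne_zero))
    obtain ⟨t, ht⟩ := AddSubgroup.mem_zmultiples_iff.1 (mem_zmultiples_starBihom hI hpb b).1
    have hbb : p • starBihom A p b b = 0 := by
      have h1 : (1 - t * p) • (p • (b ⋆ b)) ∈ isoLower A p 2 := by
        rw [← QuotientAddGroup.eq_zero_iff]
        change (1 - t * (p : ℤ)) • (p • starBihom A p b b) = 0
        rw [map_nsmul, map_nsmul, AddMonoidHom.nsmul_apply] at ht
        rw [sub_smul, one_smul, mul_smul, natCast_zsmul, ht, sub_self]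
      have h2 : IsCoprime (1 - t * (p : ℤ)) (p : ℤ) := ⟨1, t, by ring⟩
      have := mem_isolator_of_zsmul_mem h2 h1
      exact (QuotientAddGroup.eq_zero_iff _).2 this
    obtain ⟨s, hs⟩ := AddSubgroup.mem_zmultiples_iff.1 (mem_zmultiples_starBihom hI hb y).1
    rw [← hs, smul_comm, hbb, smul_zero]
  by_cases hx : ∀ n : ℤ, n ≠ 0 → n • x ∉ isoLower A p 1
  · exact hinf x hx y
  · push Not at hx
    obtain ⟨n, hn, hx⟩ := hx
    -- Here `x` has finite order modulo `I_1`, so `x + a` has infinite order; additivity then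
    -- recovers `x`.
    have hxa : ∀ m : ℤ, m ≠ 0 → m • (x + a) ∉ isoLower A p 1 := by
      intro m hm h
      apply ha (n * m) (mul_ne_zero hn hm)
      have h1 := zsmul_mem h n
      rw [← mul_smul, smul_add] at h1
      refine (AddSubgroup.add_mem_cancel_left _ ?_).1 h1
      rw [mul_comm, mul_smul]
      exact zsmul_mem hx m
    have h1 := hinf _ hxa y
    rw [map_add, AddMonoidHom.add_apply, smul_add, hinf a ha y, add_zero] at h1
    exact h1

theorem mem_zmultiples_starBihom' {p : ℕ} (hp : p.Prime)
    (hI : ∀ S : Subbrace A, IsIdealOf S (topSubbrace A))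
    {a : A} (ha : ∀ n : ℤ, n ≠ 0 → n • a ∉ isoLower A p 1) (x y : A) :
    starBihom A p x y ∈ AddSubgroup.zmultiples (starBihom A p x x) ∧
    starBihom A p y x ∈ AddSubgroup.zmultiples (starBihom A p x x) := by
  by_cases hx : ∀ n : ℤ, n ≠ 0 → n • x ∉ isoLower A p 1
  · exact mem_zmultiples_starBihom hI hx y
  · push Not at hx
    obtain ⟨n, hn, hx⟩ := hx
    -- Adding `p • a` makes the order infinite without changing any value of the map, since `p`
    -- kills those values.
    have hxa : ∀ m : ℤ, m ≠ 0 → m • (x + p • a) ∉ isoLower A p 1 := by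
      intro m hm h
      apply ha (n * m * p) (mul_ne_zero (mul_ne_zero hn hm) (by exact_mod_cast hp.ne_zero))
      have h1 := zsmul_mem h n
      rw [← mul_smul, smul_add] at h1
      rw [mul_smul, natCast_zsmul]
      refine (AddSubgroup.add_mem_cancel_left _ ?_).1 h1
      rw [mul_comm, mul_smul]
      exact zsmul_mem hx m
    have h1 : ∀ y, starBihom A p (x + p • a) y = starBihom A p x y := fun y => by
      rw [map_add, AddMonoidHom.add_apply, map_nsmul, AddMonoidHom.nsmul_apply,
        starBihom_torsion hp hI ha, add_zero]
    have h2 : ∀ y, starBihom A p y (x + p • a) = starBihom A p y x := fun y => by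
      rw [map_add, map_nsmul, starBihom_torsion hp hI ha, add_zero]
    have := mem_zmultiples_starBihom hI hxa y
    rwa [h1, h1, h2, h2] at this

theorem nsmul_mem_isoLower {p : ℕ} (hp : p.Prime)
    (hI : ∀ S : Subbrace A, IsIdealOf S (topSubbrace A))
    {a : A} (ha : ∀ n : ℤ, n ≠ 0 → n • a ∉ isoLower A p 1) (i : ℕ) :
    ∀ x ∈ isoLower A p (i + 1), p • x ∈ isoLower A p (i + 2) := by
  have key : ∀ j, (∀ x ∈ isoLower A p j, ∀ y,
      p • (x ⋆ y) ∈ isoLower A p (j + 2) ∧ p • (y ⋆ x) ∈ isoLower A p (j + 2)) →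
      ∀ x ∈ isoLower A p (j + 1), p • x ∈ isoLower A p (j + 2) := by
    rintro j h x ⟨m, hm, hx⟩
    refine mem_isolator_of_nsmul_mem hm ?_
    rw [smul_comm]
    have hle : lowerStarCentralSeries A (j + 1) ≤
        (isoLower A p (j + 2)).comap (nsmulAddMonoidHom p) :=
      lower_succ_le_iff.2 fun x hx => h x (le_isolator _ _ hx)
    exact hle hx
  induction i with
  | zero =>
    refine key 0 fun x _ y => ⟨?_, ?_⟩
    · exact (QuotientAddGroup.eq_zero_iff _).1 (starBihom_torsion hp hI ha x y)
    · exact (QuotientAddGroup.eq_zero_iff _).1 (starBihom_torsion hp hI ha y x)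
  | succ i ih =>
    refine key (i + 1) fun x hx y => ⟨?_, ?_⟩
    · have h1 := (starCentral_isoLower p (i + 2)).zsmul_star_sub_mem
        (fun y => (starCentral_isoLower p (i + 1)).right x hx y) p y
      rw [natCast_zsmul, natCast_zsmul] at h1
      have h2 := (starCentral_isoLower p (i + 2)).right _ (ih x hx) y
      have := sub_mem h2 h1
      rwa [sub_sub_cancel] at this
    · rw [← star_nsmul]
      exact (starCentral_isoLower p (i + 2)).left _ (ih x hx) y

/-! ### Cyclic factors, index and Sylow subgroups. -/

/-- The witness is `p ^ i • a`: each factor `p` moves its star products one term down. -/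
theorem exists_star_mem_isoLower {p : ℕ} (hp : p.Prime)
    (hI : ∀ S : Subbrace A, IsIdealOf S (topSubbrace A))
    {a : A} (ha : ∀ n : ℤ, n ≠ 0 → n • a ∉ isoLower A p 1) (i : ℕ) :
    ∃ z : A, (∀ n : ℤ, n ≠ 0 → n • z ∉ isoLower A p 1) ∧
      ∀ y, z ⋆ y ∈ isoLower A p (i + 1) ∧ y ⋆ z ∈ isoLower A p (i + 1) := by
  induction i with
  | zero =>
    exact ⟨a, ha, fun y => ⟨(starCentral_isoLower p 0).right _ (mem_isoLower_zero p a) y,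
      (starCentral_isoLower p 0).left _ (mem_isoLower_zero p a) y⟩⟩
  | succ i ih =>
    obtain ⟨z, hz, hzy⟩ := ih
    have hpi := nsmul_mem_isoLower hp hI ha i
    refine ⟨p • z, fun n hn => ?_, fun y => ⟨?_, ?_⟩⟩
    · rw [← natCast_zsmul, ← mul_smul]
      exact hz _ (mul_ne_zero hn (by exact_mod_cast hp.ne_zero))
    · have h1 := (starCentral_isoLower p (i + 1)).zsmul_star_sub_mem (fun y => (hzy y).1) p y
      rw [natCast_zsmul, natCast_zsmul] at h1
      have := add_mem h1 (hpi _ (hzy y).1)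
      rwa [sub_add_cancel] at this
    · rw [star_nsmul]
      exact hpi _ (hzy y).2

/-- Modulo the next term, every term after the first is generated by a single element. -/
theorem exists_isoLower_le {p : ℕ} (hp : p.Prime)
    (hI : ∀ S : Subbrace A, IsIdealOf S (topSubbrace A))
    {a : A} (ha : ∀ n : ℤ, n ≠ 0 → n • a ∉ isoLower A p 1) (i : ℕ) :
    ∃ c ∈ isoLower A p (i + 1),
      isoLower A p (i + 1) ≤ AddSubgroup.zmultiples c ⊔ isoLower A p (i + 2) := by
  induction i with
  | zero =>
    obtain ⟨b, hb⟩ := exists_zmultiples_of_biadditive hp (starBihom A p)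
      (starBihom_torsion hp hI ha) fun x y => ⟨(mem_zmultiples_starBihom' hp hI ha x y).1,
        (mem_zmultiples_starBihom' hp hI ha y x).2⟩
    refine ⟨b ⋆ b, (starCentral_isoLower p 0).right b (mem_isoLower_zero p b) b,
      isoLower_succ_le ?_ fun x hx =>
        (le_sup_right : isoLower A p 2 ≤ _) (nsmul_mem_isoLower hp hI ha 0 x hx)⟩
    have key : ∀ x y : A, x ⋆ y ∈ AddSubgroup.zmultiples (b ⋆ b) ⊔ isoLower A p 2 := by
      intro x y
      obtain ⟨n, hn⟩ := AddSubgroup.mem_zmultiples_iff.1 (hb x y)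
      have h1 : -(n • (b ⋆ b)) + x ⋆ y ∈ isoLower A p 2 := QuotientAddGroup.eq.1 hn
      have := AddSubgroup.add_mem_sup (zsmul_mem (AddSubgroup.mem_zmultiples (b ⋆ b)) n) h1
      rwa [add_neg_cancel_left] at this
    exact fun x _ y => ⟨key x y, key y x⟩
  | succ i ih =>
    obtain ⟨c, hc, hle⟩ := ih
    -- Since `z` is `⋆`-central modulo `D`, `c + z` has the same star products as `c` there, but
    -- infinite order modulo `I_1`. This removes the linear term, leaving only multiples of `c ⋆ c`.
    obtain ⟨z, hz, hzy⟩ := exists_star_mem_isoLower hp hI ha (i + 2)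
    have hC := starCentral_isoLower (A := A) p (i + 1)
    have hD := starCentral_isoLower (A := A) p (i + 2)
    set D := isoLower A p (i + 3) with hDdef
    set E := AddSubgroup.zmultiples (c ⋆ c) ⊔ D with hE
    have hDE : D ≤ E := le_sup_right
    refine ⟨c ⋆ c, hC.right c hc c,
      isoLower_succ_le ?_ fun x hx => hDE (nsmul_mem_isoLower hp hI ha (i + 1) x hx)⟩
    have hzC : ∀ y, z ⋆ y ∈ isoLower A p (i + 2) := fun y => hD.le (hzy y).1
    have hczC : ∀ y, (c + z) ⋆ y ∈ isoLower A p (i + 2) := fun y =>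
      (socleMod hD.self).add_mem (x := c) (fun y => hC.right c hc y) hzC y
    have hcz : ∀ y, (c + z) ⋆ y - c ⋆ y ∈ D := fun y => by
      have := add_mem (hD.star_add_sub_mem (fun y => hC.right c hc y) hzC y) (hzy y).1
      rwa [sub_add_eq_sub_sub, sub_add_cancel] at this
    have hcz2 : (c + z) ⋆ (c + z) ∈ E := by
      have h1 : (c + z) ⋆ (c + z) = c ⋆ c + (((c + z) ⋆ c - c ⋆ c) + (c + z) ⋆ z) := by
        rw [star_add]; abel
      rw [h1]
      exact AddSubgroup.add_mem_sup (AddSubgroup.mem_zmultiples _)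
        (add_mem (hcz c) (hzy _).2)
    have hE1 : E ≤ isoLower A p 1 := by
      refine le_trans (sup_le (AddSubgroup.zmultiples_le.2 (hC.right c hc c)) hD.le) ?_
      exact isoLower_antitone p (by omega)
    have hc1 : c ∈ isoLower A p 1 := isoLower_antitone p (by omega) hc
    have hwE : ∀ w ∈ isoLower A p 1, w ∈ AddSubgroup.zmultiples (c + z) ⊔
        (AddSubgroup.zmultiples ((c + z) ⋆ (c + z)) ⊔ D) → w ∈ E := by
      intro w hw hw'
      obtain ⟨_, h1, e, he, rfl⟩ := AddSubgroup.mem_sup.1 hw'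
      obtain ⟨s, rfl⟩ := AddSubgroup.mem_zmultiples_iff.1 h1
      have heE : e ∈ E := sup_le (AddSubgroup.zmultiples_le.2 hcz2) hDE he
      have hs : s = 0 := by
        by_contra hs
        refine hz s hs ((AddSubgroup.add_mem_cancel_left _ (zsmul_mem hc1 s)).1 ?_)
        rw [← smul_add]
        exact (AddSubgroup.add_mem_cancel_right _ (hE1 heE)).1 hw
      rwa [hs, zero_smul, zero_add]
    have hcy : ∀ y, c ⋆ y ∈ E ∧ y ⋆ c ∈ E := by
      intro y
      have h1 := star_mem_zmultiples_sup hI hD hczC y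
      have hmem : ∀ x y : A, x ⋆ y ∈ isoLower A p 1 := fun x y =>
        (starCentral_isoLower p 0).right x (mem_isoLower_zero p x) y
      have h2 := hwE _ (hmem _ _) h1.1
      have h3 := hwE _ (hmem _ _) h1.2
      constructor
      · have := sub_mem h2 (hDE (hcz y))
        rwa [sub_sub_cancel] at this
      · rw [star_add] at h3
        exact (AddSubgroup.add_mem_cancel_right _ (hDE (hzy y).2)).1 h3
    intro x hx y
    obtain ⟨_, h1, l, hl, rfl⟩ := AddSubgroup.mem_sup.1 (hle hx)
    obtain ⟨t, rfl⟩ := AddSubgroup.mem_zmultiples_iff.1 h1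
    constructor
    · refine hD.star_add_mem_of_le hDE (fun y => hC.right _ (zsmul_mem hc t) y)
        (fun y => hD.le (hD.right l hl y)) ?_ (hDE (hD.right l hl y))
      exact hD.zsmul_star_mem_of_le hDE (fun y => hC.right c hc y) (hcy y).1 t
    · rw [star_add, star_zsmul]
      exact add_mem (zsmul_mem (hcy y).2 t) (hDE (hD.left l hl y))

/-- An infinite relative index is recorded as `0`, so the bound needs the first conjunct. -/
theorem relIndex_isoLower {p : ℕ} (hp : p.Prime)
    (hI : ∀ S : Subbrace A, IsIdealOf S (topSubbrace A))
    {a : A} (ha : ∀ n : ℤ, n ≠ 0 → n • a ∉ isoLower A p 1) (i : ℕ) :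
    (isoLower A p (i + 1)).relIndex (isoLower A p 1) ≠ 0 ∧
      (isoLower A p (i + 1)).relIndex (isoLower A p 1) ≤ p ^ i := by
  induction i with
  | zero => simp
  | succ i ih =>
    rw [← AddSubgroup.relIndex_mul_relIndex _ _ _ (starCentral_isoLower (A := A) p (i + 1)).le
      (isoLower_antitone p (by omega : 1 ≤ i + 1))]
    suffices h : (isoLower A p (i + 2)).relIndex (isoLower A p (i + 1)) ≠ 0 ∧
        (isoLower A p (i + 2)).relIndex (isoLower A p (i + 1)) ≤ p by
      refine ⟨mul_ne_zero h.1 ih.1, ?_⟩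
      rw [pow_succ']
      exact Nat.mul_le_mul h.2 ih.2
    obtain ⟨c, hc, hle⟩ := exists_isoLower_le hp hI ha i
    set π := QuotientAddGroup.mk' (isoLower A p (i + 2)) with hπ
    have hpc : p • π c = 0 := by
      rw [← map_nsmul]
      exact (QuotientAddGroup.eq_zero_iff _).2 (nsmul_mem_isoLower hp hI ha i c hc)
    have hmap : (isoLower A p (i + 1)).map π ≤ AddSubgroup.zmultiples (π c) := by
      refine (AddSubgroup.map_mono hle).trans ?_
      rw [AddSubgroup.map_sup, AddMonoidHom.map_zmultiples]
      refine sup_le le_rfl ?_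
      rintro _ ⟨x, hx, rfl⟩
      have hx0 : π x = 0 := (QuotientAddGroup.eq_zero_iff x).2 hx
      rw [hx0]
      exact zero_mem _
    have hfin : Finite (AddSubgroup.zmultiples (π c)) :=
      finite_zmultiples.2 (isOfFinAddOrder_iff_nsmul_eq_zero.2 ⟨p, hp.pos, hpc⟩)
    have hcard : (isoLower A p (i + 2)).relIndex (isoLower A p (i + 1)) =
        Nat.card ((isoLower A p (i + 1)).map π) := by
      rw [← AddSubgroup.relIndex_ker, hπ, QuotientAddGroup.ker_mk']
    have hfin' : Finite ((isoLower A p (i + 1)).map π) :=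
      Finite.of_injective _ (AddSubgroup.inclusion_injective hmap)
    rw [hcard]
    refine ⟨Nat.card_pos.ne', (AddSubgroup.card_le_of_le hmap).trans ?_⟩
    rw [Nat.card_zmultiples]
    exact Nat.le_of_dvd hp.pos (addOrderOf_dvd_of_nsmul_eq_zero hpc)

theorem finite_sylow_and_card_le {p k N : ℕ} (hbot : lowerStarCentralSeries A k = ⊥)
    (hidx : (isoLower A p k).relIndex (isoLower A p 1) ≠ 0 ∧
      (isoLower A p k).relIndex (isoLower A p 1) ≤ N)
    {K : AddSubgroup A} (hK1 : K ≤ isoLower A p 1) (P : Sylow p (Multiplicative K)) :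
    Finite P ∧ Nat.card P ≤ N := by
  set Q : AddSubgroup A := (Subgroup.toAddSubgroup' P.toSubgroup).map K.subtype with hQ
  have hQ1 : Q ≤ isoLower A p 1 := by
    rintro _ ⟨x, _, rfl⟩
    exact hK1 x.2
  -- As `L_k = 0`, elements of `I_k` have order prime to `p`, while those of `Q` have `p`-power
  -- order.
  have hQk : isoLower A p k ⊓ Q = ⊥ := by
    refine (AddSubgroup.eq_bot_iff_forall _).2 ?_
    rintro _ ⟨⟨m, hm, hx⟩, ⟨x, hxP, rfl⟩⟩
    rw [hbot, AddSubgroup.mem_bot] at hx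
    obtain ⟨n, hn⟩ := P.isPGroup' ⟨Multiplicative.ofAdd x, hxP⟩
    have hn' : p ^ n • (x : A) = 0 := congrArg (fun y : K => (y : A)) (congrArg Subtype.val hn)
    have h1 := Nat.dvd_gcd (addOrderOf_dvd_of_nsmul_eq_zero hx)
      (addOrderOf_dvd_of_nsmul_eq_zero hn')
    rw [Nat.Coprime.gcd_eq_one (Nat.Coprime.pow_right n hm), Nat.dvd_one] at h1
    exact AddMonoid.addOrderOf_eq_one_iff.1 h1
  have hcard : Nat.card P = (isoLower A p k).relIndex Q := by
    rw [← AddSubgroup.inf_relIndex_right, hQk, AddSubgroup.relIndex_bot_left, hQ]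
    exact Nat.card_congr (AddSubgroup.equivMapOfInjective (Subgroup.toAddSubgroup' P.toSubgroup)
      _ K.subtype_injective).toEquiv
  have hle : (isoLower A p k).relIndex Q ≤ (isoLower A p k).relIndex (isoLower A p 1) :=
    AddSubgroup.relIndex_le_of_le_right hQ1 hidx.1
  have hne : (isoLower A p k).relIndex Q ≠ 0 :=
    mt (AddSubgroup.relIndex_eq_zero_of_le_right hQ1) hidx.1
  rw [← hcard] at hne hle
  exact ⟨Nat.finite_of_card_ne_zero hne, hle.trans hidx.2⟩

end PrimeExponent
end LeftBrace

theorem mainTheorem5 {A : Type u} [LeftBrace A] (hT : LeftBrace.IsTBrace A)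
    (hS : LeftBrace.IsSmoktunowiczNilpotent A)
    (k : ℕ) (hk : 0 < k) (hzl : LeftBrace.zl A = (k : Ordinal.{u}))
    (hA : ¬ IsAddTorsion A) (p : ℕ) (hp : p.Prime)
    (P : Sylow p (Multiplicative (LeftBrace.starProd (Set.univ : Set A) Set.univ))) :
    Finite P ∧ Nat.card P ≤ p ^ (k - 1) := by
  open LeftBrace in
  have hbot := lower_eq_bot hS hk hzl
  obtain ⟨a, ha⟩ := exists_nsmul_notMem_isoLower_one hp hbot hA
  have hidx := relIndex_isoLower hp (isIdealOf_top hT hbot) ha (k - 1)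
  rw [Nat.sub_add_cancel hk] at hidx
  refine finite_sylow_and_card_le hbot hidx ((AddSubgroup.closure_le _).2 ?_) P
  rintro _ ⟨x, _, y, _, rfl⟩
  exact (starCentral_isoLower p 0).right x (mem_isoLower_zero p x) y
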